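/- For $n\ge 0$ let $$G_n=\langle x_1,\dots,x_n \mid x_i^{-1}x_j^{2}x_i x_j^{2}\ \text{ for all } i\neq j\rangle$$ be the combinatorial Hantzsche-Wendt group. Then: 1. for $n>1$, the abelianization of $G_n$ is isomorphic to $(\mathbb{Z}/4)^n$; 2. for $n>1$, the center of $G_n$ is trivial; 3. for $n\ge 1$, the rational homology $H_i(G_n;\mathbb{Q})$ (trivial coefficients) is finite-dimensional for every $i$ and zero for all sufficiently large $i$, and the Euler characteristic $\chi(G_n)=\sum_{i\ge 0}(-1)^i\dim_{\mathbb{Q}}H_i(G_n;\mathbb{Q})$ is equal to $0$; and for $n>1$, the first Betti number $b_1(G_n)=\dim_{\mathbb{Q}}H_1(G_n;\mathbb{Q})$ is equal to $0$. -/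

import Mathlib

namespace HantzscheWendt

/-- The relators `x_i⁻¹ x_j² x_i x_j²`, for all `i ≠ j`, in the free group on `x_1, …, x_n`. -/
def relators (n : ℕ) : Set (FreeGroup (Fin n)) :=
  {r | ∃ i j : Fin n, i ≠ j ∧
    r = (FreeGroup.of i)⁻¹ * (FreeGroup.of j) ^ 2 * FreeGroup.of i * (FreeGroup.of j) ^ 2}

/-- The combinatorial Hantzsche-Wendt group
`G_n = ⟨x_1, …, x_n | x_i⁻¹ x_j² x_i x_j² for all i ≠ j⟩`. -/
abbrev G (n : ℕ) : Type := PresentedGroup (relators n)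

/-- The rational homology `H_i(Γ; ℚ)` of a group `Γ` (with trivial action on `ℚ`), which is the
rational homology of a classifying space `K(Γ, 1)`. -/
noncomputable abbrev rationalHomology (Γ : Type) [Group Γ] (i : ℕ) : ModuleCat ℚ :=
  groupHomology (Rep.trivial ℚ Γ ℚ) i

/-- The total rational homology of `Γ` is finite-dimensional: every `H_i(Γ; ℚ)` is
finite-dimensional, and it vanishes for all large `i`.  This is what makes the Euler
characteristic of `Γ` well defined. -/
def HasFiniteRationalHomology (Γ : Type) [Group Γ] : Prop :=
  (∀ i : ℕ, Module.Finite ℚ (rationalHomology Γ i)) ∧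
    ∃ N : ℕ, ∀ i : ℕ, N < i → Subsingleton (rationalHomology Γ i)

/-- The `i`-th Betti number `dim_ℚ H_i(Γ; ℚ)`. -/
noncomputable def bettiNumber (Γ : Type) [Group Γ] (i : ℕ) : ℕ :=
  Module.finrank ℚ (rationalHomology Γ i)

/-- The Euler characteristic `∑_i (-1)^i dim_ℚ H_i(Γ; ℚ)`, to be used only together with
`HasFiniteRationalHomology Γ`. -/
noncomputable def eulerCharacteristic (Γ : Type) [Group Γ] : ℤ :=
  ∑ᶠ i : ℕ, (-1 : ℤ) ^ i * (bettiNumber Γ i : ℤ)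

end HantzscheWendt

/-! Let `A` be the subgroup generated by the squares `x_i²`. The relators say that `x_i` inverts
`x_j²` for `i ≠ j`, so `A` is normal, and `G_n / A` is a free product of `n` copies of `ℤ/2`.

Homology: over `ℚ` the augmentation ideal of this free product splits as the direct sum over `j` of
modules induced from the sign character of `⟨x_j⟩`. Hence `0 → edgeRep → ℚ[G_n/A] → ℚ → 0` is exact;
a Fox-type derivation provides the contraction (`boundary_injective`, `augmentation_eq_zero_iff`).
Both left terms come from free modules of finite rank by iterating cokernels of injective
endomorphisms `σ - c : M → M`. Each such cokernel has finite homology and Euler characteristic `χ(M)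
- χ(M) = 0` (`finiteHomology_of_shift`), and additivity gives the result for `ℚ`.

Abelianization: the relators become `x_j⁴`, so `H_1(G_n; ℚ)` is torsion tensored with `ℚ`, hence
zero.

Center: a central element maps into every factor `⟨x_j⟩` of the free product
(`mem_vertexGroup_of_mem_center`), so it lies in `A`. There it acts on each coordinate line by a
translation commuting with a reflection, hence trivially. -/

open CategoryTheory

namespace HantzscheWendt

/-! ### Ranks in exact sequences -/

section LinearAlgebra

/-- Truncated alternating sums of the dimensions in a long exact sequence, where `r`, `s`, `d` are
the ranks of its maps. -/
theorem alternating_sum_of_rank_identities {h₁ h₂ h₃ r s d : ℕ → ℕ}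
    (e₁ : ∀ i, h₁ i = d i + r i) (e₂ : ∀ i, h₂ i = r i + s i)
    (e₀ : h₃ 0 = s 0) (e₃ : ∀ i, h₃ (i + 1) = s (i + 1) + d i) (N : ℕ) :
    ∑ i ∈ Finset.range (N + 1), (-1 : ℤ) ^ i * (h₂ i : ℤ) =
      ∑ i ∈ Finset.range (N + 1), (-1 : ℤ) ^ i * (h₁ i : ℤ) +
      ∑ i ∈ Finset.range (N + 1), (-1 : ℤ) ^ i * (h₃ i : ℤ) - (-1) ^ N * (d N : ℤ) := by
  induction N with
  | zero => simp [e₁, e₂, e₀]; ring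
  | succ N ih =>
    rw [Finset.sum_range_succ, ih, Finset.sum_range_succ _ (N + 1),
      Finset.sum_range_succ _ (N + 1), e₁ (N + 1), e₂ (N + 1), e₃ N]
    push_cast
    ring

theorem finrank_eq_add_of_exact {U V W : Type*} [AddCommGroup U] [Module ℚ U] [AddCommGroup V]
    [Module ℚ V] [AddCommGroup W] [Module ℚ W] [Module.Finite ℚ V] {f : U →ₗ[ℚ] V} {g : V →ₗ[ℚ] W}
    (h : Function.Exact f g) :
    Module.finrank ℚ V = Module.finrank ℚ (LinearMap.range f) +
      Module.finrank ℚ (LinearMap.range g) := by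
  rw [← LinearMap.finrank_range_add_finrank_ker g, LinearMap.exact_iff.1 h, add_comm]

theorem finite_of_exact {U V W : Type*} [AddCommGroup U] [Module ℚ U] [AddCommGroup V]
    [Module ℚ V] [AddCommGroup W] [Module ℚ W] [Module.Finite ℚ U] [Module.Finite ℚ W]
    {f : U →ₗ[ℚ] V} {g : V →ₗ[ℚ] W} (h : Function.Exact f g) : Module.Finite ℚ V := by
  have : Module.Finite ℚ (LinearMap.ker g) := by
    rw [LinearMap.exact_iff.1 h]; infer_instance
  have : Module.Finite ℚ (V ⧸ LinearMap.ker g) :=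
    Module.Finite.equiv g.quotKerEquivRange.symm
  exact Module.Finite.of_submodule_quotient (LinearMap.ker g)

end LinearAlgebra

/-! ### Euler characteristics with coefficients and their additivity -/

variable {Γ : Type} [Group Γ]

/-- The total homology of `Γ` with coefficients in `A` is finite-dimensional. -/
def FiniteHomology (A : Rep.{0} ℚ Γ) : Prop :=
  (∀ i : ℕ, Module.Finite ℚ (groupHomology A i)) ∧
    ∃ N : ℕ, ∀ i : ℕ, N < i → Subsingleton (groupHomology A i)

/-- The Euler characteristic of `Γ` with coefficients in `A`. -/
noncomputable def eulerChar (A : Rep.{0} ℚ Γ) : ℤ :=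
  ∑ᶠ i : ℕ, (-1 : ℤ) ^ i * (Module.finrank ℚ (groupHomology A i) : ℤ)

theorem eulerChar_eq_sum_range {A : Rep.{0} ℚ Γ} {N : ℕ}
    (h : ∀ i, N < i → Subsingleton (groupHomology A i)) :
    eulerChar A =
      ∑ i ∈ Finset.range (N + 1), (-1 : ℤ) ^ i * (Module.finrank ℚ (groupHomology A i) : ℤ) := by
  refine finsum_eq_sum_of_support_subset _ fun i hi => ?_
  by_contra hi'
  have := h i (by simpa using hi')
  exact hi (by simp [Module.finrank_zero_of_subsingleton])

section LongExactSequence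

variable {X : ShortComplex (Rep.{0} ℚ Γ)} (hX : X.ShortExact)
include hX

theorem exact_map_map (i : ℕ) :
    Function.Exact (groupHomology.map (MonoidHom.id Γ) X.f i).hom
      (groupHomology.map (MonoidHom.id Γ) X.g i).hom :=
  (ShortComplex.ShortExact.moduleCat_exact_iff_function_exact _).1
    (groupHomology.mapShortComplex₂_exact hX i)

theorem exact_map_δ (i : ℕ) :
    Function.Exact (groupHomology.map (MonoidHom.id Γ) X.g (i + 1)).hom
      (groupHomology.δ hX (i + 1) i rfl).hom :=
  (ShortComplex.ShortExact.moduleCat_exact_iff_function_exact _).1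
    (groupHomology.mapShortComplex₃_exact hX (i := i + 1) (j := i) rfl)

theorem exact_δ_map (i : ℕ) :
    Function.Exact (groupHomology.δ hX (i + 1) i rfl).hom
      (groupHomology.map (MonoidHom.id Γ) X.f i).hom :=
  (ShortComplex.ShortExact.moduleCat_exact_iff_function_exact _).1
    (groupHomology.mapShortComplex₁_exact hX (i := i + 1) (j := i) rfl)

theorem map_zero_surjective :
    Function.Surjective (groupHomology.map (MonoidHom.id Γ) X.g 0).hom := by
  have := hX.epi_g
  exact (ModuleCat.epi_iff_surjective _).1 (groupHomology.epi_map_0_of_epi X.g)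

/-- In the long exact sequence `H_{i+1}(X₃)` lies between `H_{i+1}(X₂)` and `H_i(X₁)`; the degree
shift accounts for the extra `1` in the bound. -/
theorem FiniteHomology.right (h₁ : FiniteHomology X.X₁) (h₂ : FiniteHomology X.X₂) :
    FiniteHomology X.X₃ := by
  obtain ⟨f₁, N₁, v₁⟩ := h₁
  obtain ⟨f₂, N₂, v₂⟩ := h₂
  refine ⟨fun i => ?_, N₁ + N₂ + 1, fun i hi => ?_⟩
  · have := f₂ i
    cases i with
    | zero => exact Module.Finite.of_surjective _ (map_zero_surjective hX)
    | succ i =>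
      have := f₁ i
      exact finite_of_exact (exact_map_δ hX i)
  · obtain ⟨i, rfl⟩ : ∃ j, i = j + 1 := ⟨i - 1, by omega⟩
    have := v₁ i (by omega)
    have := v₂ (i + 1) (by omega)
    refine ⟨fun a b => ?_⟩
    have key : ∀ a : groupHomology X.X₃ (i + 1), a = 0 := fun a => by
      obtain ⟨c, rfl⟩ := (exact_map_δ hX i a).1 (Subsingleton.elim _ _)
      rw [Subsingleton.elim c 0, map_zero]
    rw [key a, key b]

theorem eulerChar_middle (h₁ : FiniteHomology X.X₁) (h₂ : FiniteHomology X.X₂) :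
    eulerChar X.X₂ = eulerChar X.X₁ + eulerChar X.X₃ := by
  obtain ⟨f₃, N₃, v₃⟩ := h₁.right hX h₂
  obtain ⟨f₁, N₁, v₁⟩ := h₁
  obtain ⟨f₂, N₂, v₂⟩ := h₂
  rw [eulerChar_eq_sum_range (N := N₁ + N₂ + N₃) fun i hi => v₁ i (by omega),
    eulerChar_eq_sum_range (N := N₁ + N₂ + N₃) fun i hi => v₂ i (by omega),
    eulerChar_eq_sum_range (N := N₁ + N₂ + N₃) fun i hi => v₃ i (by omega)]
  rw [alternating_sum_of_rank_identities
    (h₃ := fun i => Module.finrank ℚ (groupHomology X.X₃ i))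
    (d := fun i => Module.finrank ℚ (LinearMap.range (groupHomology.δ hX (i + 1) i rfl).hom))
    (r := fun i => Module.finrank ℚ
      (LinearMap.range (groupHomology.map (MonoidHom.id Γ) X.f i).hom))
    (s := fun i => Module.finrank ℚ
      (LinearMap.range (groupHomology.map (MonoidHom.id Γ) X.g i).hom))
    (fun i => have := f₁ i; finrank_eq_add_of_exact (exact_δ_map hX i))
    (fun i => have := f₂ i; finrank_eq_add_of_exact (exact_map_map hX i))
    (by rw [LinearMap.range_eq_top.2 (map_zero_surjective hX), finrank_top])
    (fun i => have := f₃ (i + 1); finrank_eq_add_of_exact (exact_map_δ hX i))]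
  -- The truncation error is the rank of a connecting map whose source lies above the vanishing
  -- bound for `X₃`.
  have := v₃ (N₁ + N₂ + N₃ + 1) (by omega)
  have h0 : Module.finrank ℚ (LinearMap.range
      (groupHomology.δ hX (N₁ + N₂ + N₃ + 1) (N₁ + N₂ + N₃) rfl).hom) = 0 := by
    rw [Module.finrank_zero_iff, Submodule.subsingleton_iff_eq_bot, LinearMap.range_eq_bot]
    ext x
    rw [Subsingleton.elim x 0, map_zero, map_zero]
  rw [h0]
  simp

end LongExactSequence

theorem shortExact_of_linear {A B C : Rep.{0} ℚ Γ} (f : A ⟶ B) (g : B ⟶ C)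
    (hf : Function.Injective f.hom) (hg : Function.Surjective g.hom)
    (h : ∀ b, g.hom b = 0 ↔ ∃ a, f.hom a = b) :
    ∃ w : f ≫ g = 0, (ShortComplex.mk f g w).ShortExact := by
  have w : f ≫ g = 0 := by
    ext x
    exact (h _).2 ⟨x, rfl⟩
  refine ⟨w, ?_⟩
  have := (Rep.mono_iff_injective f).2 hf
  have := (Rep.epi_iff_surjective g).2 hg
  have e : (ShortComplex.mk f g w).Exact := by
    rw [← ShortComplex.exact_map_iff_of_faithful _ (forget₂ (Rep.{0} ℚ Γ) (ModuleCat ℚ)),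
      ShortComplex.ShortExact.moduleCat_exact_iff_function_exact]
    exact h
  exact ⟨e⟩

theorem finiteHomology_of_linear {A B C : Rep.{0} ℚ Γ} (f : A ⟶ B) (g : B ⟶ C)
    (hf : Function.Injective f.hom) (hg : Function.Surjective g.hom)
    (h : ∀ b, g.hom b = 0 ↔ ∃ a, f.hom a = b) (hA : FiniteHomology A) (hB : FiniteHomology B) :
    FiniteHomology C ∧ eulerChar C = eulerChar B - eulerChar A := by
  obtain ⟨w, hX⟩ := shortExact_of_linear f g hf hg h
  have := eulerChar_middle hX hA hB
  exact ⟨FiniteHomology.right hX hA hB, by simp_all⟩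

theorem FiniteHomology.of_iso {A B : Rep.{0} ℚ Γ} (e : A ≅ B) (h : FiniteHomology A) :
    FiniteHomology B := by
  have E : ∀ i, groupHomology A i ≃ₗ[ℚ] groupHomology B i := fun i =>
    ((groupHomology.functor ℚ Γ i).mapIso e).toLinearEquiv
  obtain ⟨f, N, v⟩ := h
  exact ⟨fun i => have := f i; Module.Finite.equiv (E i),
    N, fun i hi => have := v i hi; (E i).symm.toEquiv.subsingleton⟩

theorem eulerChar_congr {A B : Rep.{0} ℚ Γ} (e : A ≅ B) : eulerChar A = eulerChar B := by
  have E : ∀ i, groupHomology A i ≃ₗ[ℚ] groupHomology B i := fun i =>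
    ((groupHomology.functor ℚ Γ i).mapIso e).toLinearEquiv
  simp only [eulerChar, fun i => (E i).finrank_eq]

theorem nonempty_iso_of_bijective {A B : Rep.{0} ℚ Γ} (f : A ⟶ B)
    (hf : Function.Bijective f.hom) : Nonempty (A ≅ B) := by
  have := (Rep.mono_iff_injective f).2 hf.1
  have := (Rep.epi_iff_surjective f).2 hf.2
  have := isIso_of_mono_of_epi f
  exact ⟨asIso f⟩

/-! ### Permutation representations and free modules -/

variable (Γ) in
/-- The permutation representation on `X →₀ ℚ` of a `Γ`-set `X`. -/
noncomputable def permRepresentation (X : Type) [MulAction Γ X] :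
    Representation ℚ Γ (X →₀ ℚ) where
  toFun g := Finsupp.lmapDomain ℚ ℚ (g • ·)
  map_one' := by ext; simp
  map_mul' g h := by ext; simp [mul_smul]

variable (Γ) in
/-- The permutation representation as an object of `Rep ℚ Γ`. -/
noncomputable abbrev permRep (X : Type) [MulAction Γ X] : Rep.{0} ℚ Γ :=
  Rep.of (permRepresentation Γ X)

@[simp]
theorem permRepresentation_single {X : Type} [MulAction Γ X] (g : Γ) (x : X) (r : ℚ) :
    permRepresentation Γ X g (Finsupp.single x r) = Finsupp.single (g • x) r :=
  Finsupp.mapDomain_single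

/-- The map of representations given by a linear map which is equivariant on the basis. -/
noncomputable def permRepHom {X : Type} [MulAction Γ X] {A : Rep.{0} ℚ Γ}
    (f : (X →₀ ℚ) →ₗ[ℚ] A) (h : ∀ (g : Γ) (x : X),
      f (Finsupp.single (g • x) 1) = A.ρ g (f (Finsupp.single x 1))) : permRep Γ X ⟶ A :=
  Rep.ofHom (σ := A.ρ) (ρ := permRepresentation Γ X) ⟨f, fun g => by
    refine Finsupp.lhom_ext' fun x => LinearMap.ext_ring ?_
    simpa using h g x⟩

section Free

variable {I X : Type} [MulAction Γ X]

/-- If `(i, g) ↦ g • b i` is a bijection onto `X`, then the permutation representation on `X`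
is induced from the trivial subgroup. -/
theorem exists_indBot_bijective (b : I → X) (hb : Function.Bijective fun p : I × Γ => p.2 • b p.1) :
    ∃ φ : Rep.ind (⊥ : Subgroup Γ).subtype (Rep.trivial ℚ (⊥ : Subgroup Γ) (I →₀ ℚ)) ⟶ permRep Γ X,
      Function.Bijective φ.hom := by
  let e := Equiv.ofBijective _ hb
  have he : ∀ i g, e.symm (g • b i) = (i, g) := fun i g => e.symm_apply_apply (i, g)
  let m := Representation.IndV.mk (⊥ : Subgroup Γ).subtype
      (Rep.trivial ℚ (⊥ : Subgroup Γ) (I →₀ ℚ)).ρ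
  let ψ : (X →₀ ℚ) →ₗ[ℚ]
      Rep.ind (⊥ : Subgroup Γ).subtype (Rep.trivial ℚ (⊥ : Subgroup Γ) (I →₀ ℚ)) :=
    -- The inverse is forced by the convention that `m g v` corresponds to `g⁻¹` applied to the
    -- image of `v`.
    Finsupp.linearCombination ℚ fun x => m (e.symm x).2⁻¹ (Finsupp.single (e.symm x).1 1)
  let φ : Rep.ind (⊥ : Subgroup Γ).subtype (Rep.trivial ℚ (⊥ : Subgroup Γ) (I →₀ ℚ)) ⟶
      permRep Γ X := (Rep.indResHomEquiv _ _ _).symm <| Rep.ofHom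
    ⟨Finsupp.lmapDomain ℚ ℚ b, fun g => by
      obtain rfl : g = 1 := Subsingleton.elim _ _
      ext
      simp⟩
  have hφ : ∀ g i, φ.hom (m g (Finsupp.single i 1)) = Finsupp.single (g⁻¹ • b i) (1 : ℚ) :=
    fun g i => by
      simp [φ, m]
  refine ⟨φ, Function.bijective_iff_has_inverse.2 ⟨ψ, fun x => ?_, fun x => ?_⟩⟩
  · have : ψ ∘ₗ φ.hom.toLinearMap = LinearMap.id := by
      refine Representation.IndV.hom_ext _ _ fun g =>
        Finsupp.lhom_ext' fun i => LinearMap.ext_ring ?_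
      change ψ (φ.hom (m g (Finsupp.single i 1))) = m g (Finsupp.single i 1)
      rw [hφ]
      simp [ψ, he]
    exact LinearMap.congr_fun this x
  · have : φ.hom.toLinearMap ∘ₗ ψ = LinearMap.id := by
      refine Finsupp.lhom_ext' fun x => LinearMap.ext_ring ?_
      change φ.hom (ψ (Finsupp.single x 1)) = Finsupp.single x 1
      obtain ⟨⟨i, g⟩, rfl⟩ := e.surjective x
      simp only [ψ, Finsupp.linearCombination_single, one_smul, Equiv.symm_apply_apply]
      rw [hφ, inv_inv]
      rfl
    exact LinearMap.congr_fun this x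

/-- A permutation representation which is free of finite rank has finite-dimensional homology. -/
theorem finiteHomology_permRep_of_free [Finite I] (b : I → X)
    (hb : Function.Bijective fun p : I × Γ => p.2 • b p.1) : FiniteHomology (permRep Γ X) := by
  classical
  obtain ⟨φ, hφ⟩ := exists_indBot_bijective b hb
  obtain ⟨e⟩ := nonempty_iso_of_bijective φ hφ
  refine FiniteHomology.of_iso e ?_
  -- Shapiro's lemma reduces to the trivial group, whose homology is concentrated in degree `0`.
  have E := fun i => (groupHomology.indIso (⊥ : Subgroup Γ)
    (Rep.trivial ℚ (⊥ : Subgroup Γ) (I →₀ ℚ)) i).toLinearEquiv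
  have v : ∀ i, Subsingleton (groupHomology (Rep.trivial ℚ (⊥ : Subgroup Γ) (I →₀ ℚ)) (i + 1)) :=
    fun i => ModuleCat.subsingleton_of_isZero (isZero_groupHomology_succ_of_subsingleton _ _)
  refine ⟨fun i => ?_, 0, fun i hi => ?_⟩
  · have : Module.Finite ℚ (groupHomology (Rep.trivial ℚ (⊥ : Subgroup Γ) (I →₀ ℚ)) i) := by
      cases i with
      | zero =>
        let e := (groupHomology.H0IsoOfIsTrivial
          (Rep.trivial ℚ (⊥ : Subgroup Γ) (I →₀ ℚ))).symm.toLinearEquiv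
        have : Module.Finite ℚ (Rep.trivial ℚ (⊥ : Subgroup Γ) (I →₀ ℚ)).V :=
          inferInstanceAs (Module.Finite ℚ (I →₀ ℚ))
        exact Module.Finite.equiv e
      | succ i => infer_instance
    exact Module.Finite.equiv (E i).symm
  · obtain ⟨j, rfl⟩ : ∃ j, i = j + 1 := ⟨i - 1, by omega⟩
    exact (E (j + 1)).toEquiv.subsingleton

end Free

/-! ### Cokernels of shift operators -/

section Shift

variable {X : Type}

/-- The operator `σ - c` on `X →₀ ℚ`. -/
noncomputable def shiftSub (σ : X → X) (c : ℚ) : (X →₀ ℚ) →ₗ[ℚ] (X →₀ ℚ) :=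
  Finsupp.lmapDomain ℚ ℚ σ - c • LinearMap.id

@[simp]
theorem shiftSub_single (σ : X → X) (c : ℚ) (x : X) (r : ℚ) :
    shiftSub σ c (Finsupp.single x r) = Finsupp.single (σ x) r - c • Finsupp.single x r := by
  simp [shiftSub]

/-- For `f` in the kernel, `f x = c * f (σ x)`. A nonzero value would propagate along an infinite
forward orbit, against finite support. -/
theorem shiftSub_injective {σ : X → X} (hσ : Function.Injective σ)
    (h : ∀ x, Function.Injective fun m : ℕ => σ^[m] x) (c : ℚ) :
    Function.Injective (shiftSub σ c) := by
  refine (injective_iff_map_eq_zero _).2 fun f hf => ?_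
  have hc : ∀ x, f x = c * f (σ x) := fun x => by
    have := DFunLike.congr_fun hf (σ x)
    simpa [shiftSub, Finsupp.mapDomain_apply hσ, sub_eq_zero] using this
  by_contra hne
  obtain ⟨x, hx⟩ := Finsupp.ne_iff.1 hne
  have hm : ∀ m : ℕ, f (σ^[m] x) ≠ 0 := fun m => by
    induction m with
    | zero => exact hx
    | succ m ih =>
      rw [Function.iterate_succ_apply']
      intro h0
      exact ih (by rw [hc, h0, mul_zero])
  exact Set.infinite_range_of_injective (h x)
    (f.support.finite_toSet.subset (by rintro _ ⟨m, rfl⟩; simpa using hm m))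

variable [MulAction Γ X]

/-- The operator `σ - c` as a map of representations. -/
noncomputable def shiftSubHom (σ : X → X) (hσ : ∀ (g : Γ) x, σ (g • x) = g • σ x) (c : ℚ) :
    permRep Γ X ⟶ permRep Γ X :=
  permRepHom (shiftSub σ c) fun g x => by simp [hσ]

/-- The same module `M` occurs twice in `0 → M → M → C → 0`, so its Euler characteristic cancels,
whatever its value. -/
theorem finiteHomology_of_shift {C : Rep.{0} ℚ Γ} (hX : FiniteHomology (permRep Γ X))
    {σ : X → X} (hσ : Function.Injective σ) (h : ∀ x, Function.Injective fun m : ℕ => σ^[m] x)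
    (hσΓ : ∀ (g : Γ) x, σ (g • x) = g • σ x) (c : ℚ) (π : permRep Γ X ⟶ C)
    (hπ : Function.Surjective π.hom) (hker : ∀ v, π.hom v = 0 ↔ ∃ u, shiftSub σ c u = v) :
    FiniteHomology C ∧ eulerChar C = 0 := by
  have := finiteHomology_of_linear (shiftSubHom σ hσΓ c) π (shiftSub_injective hσ h c) hπ hker hX hX
  simpa using this

/-- Modulo the image of `σ - 1` all points of a fibre of `p` agree, so for a section `s` every `w`
is congruent to `s_* p_* w`. -/
theorem mapDomain_eq_zero_iff_of_shift {Y : Type} {σ : X → X} {p : X → Y}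
    (hpσ : ∀ x, p (σ x) = p x)
    (hp : ∀ x y, p x = p y → ∃ m : ℕ, σ^[m] x = y ∨ σ^[m] y = x) (hs : Function.Surjective p)
    (v : X →₀ ℚ) : Finsupp.mapDomain p v = 0 ↔ ∃ u, shiftSub σ 1 u = v := by
  constructor
  · intro hv
    have hm : ∀ (m : ℕ) x r, Finsupp.single (σ^[m] x) r - Finsupp.single x r ∈
        LinearMap.range (shiftSub σ 1) := fun m x r => by
      induction m with
      | zero => simp
      | succ m ih =>
        rw [Function.iterate_succ_apply']
        have := (LinearMap.range (shiftSub σ 1)).add_mem ⟨Finsupp.single (σ^[m] x) r, rfl⟩ ih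
        simpa using this
    have h1 : ∀ x y r, p x = p y → Finsupp.single x r - Finsupp.single y r ∈
        LinearMap.range (shiftSub σ 1) := fun x y r hxy => by
      obtain ⟨m, rfl | rfl⟩ := hp x y hxy
      · rw [← neg_sub]
        exact neg_mem (hm m x r)
      · exact hm m y r
    obtain ⟨s, hs⟩ := hs.hasRightInverse
    have h2 : ∀ w : X →₀ ℚ, w - Finsupp.mapDomain s (Finsupp.mapDomain p w) ∈
        LinearMap.range (shiftSub σ 1) := fun w => by
      induction w using Finsupp.induction_linear with
      | zero => simp
      | add f g hf hg =>
        rw [Finsupp.mapDomain_add, Finsupp.mapDomain_add, add_sub_add_comm]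
        exact add_mem hf hg
      | single x r =>
        rw [Finsupp.mapDomain_single, Finsupp.mapDomain_single]
        exact h1 _ _ _ (hs _).symm
    have := h2 v
    rwa [hv, Finsupp.mapDomain_zero, sub_zero] at this
  · rintro ⟨u, rfl⟩
    have : Finsupp.lmapDomain ℚ ℚ p ∘ₗ shiftSub σ 1 = 0 :=
      Finsupp.lhom_ext' fun x => LinearMap.ext_ring <| by
        rw [LinearMap.comp_apply, LinearMap.comp_apply, Finsupp.lsingle_apply, shiftSub_single, map_sub]
        simp [hpσ]
    exact LinearMap.congr_fun this u

/-- The quotient of a `Γ`-set by an equivariant shift without finite orbits. -/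
theorem finiteHomology_permRep_of_shift {Y : Type} [MulAction Γ Y]
    (hX : FiniteHomology (permRep Γ X))
    {σ : X → X} (hσ : Function.Injective σ) (h : ∀ x, Function.Injective fun m : ℕ => σ^[m] x)
    (hσΓ : ∀ (g : Γ) x, σ (g • x) = g • σ x) {p : X → Y} (hpΓ : ∀ (g : Γ) x, p (g • x) = g • p x)
    (hpσ : ∀ x, p (σ x) = p x)
    (hp : ∀ x y, p x = p y → ∃ m : ℕ, σ^[m] x = y ∨ σ^[m] y = x) (hs : Function.Surjective p) :
    FiniteHomology (permRep Γ Y) ∧ eulerChar (permRep Γ Y) = 0 :=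
  finiteHomology_of_shift hX hσ h hσΓ 1
    (permRepHom (Finsupp.lmapDomain ℚ ℚ p) fun g x => by simp [hpΓ])
    (Finsupp.mapDomain_surjective hs) (mapDomain_eq_zero_iff_of_shift hpσ hp hs)

end Shift

/-! ### Right multiplication on coset spaces -/

section RightMul

/-- Right multiplication on `Γ ⧸ H` by an element normalizing `H`. -/
def cosetRightMul (H : Subgroup Γ) (a : Γ) (ha : ∀ h ∈ H, a⁻¹ * h * a ∈ H) : Γ ⧸ H → Γ ⧸ H :=
  Quotient.map' (· * a) fun g g' hg => by
    rw [QuotientGroup.leftRel_apply] at hg ⊢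
    convert ha _ hg using 1
    group

@[simp]
theorem cosetRightMul_mk (H : Subgroup Γ) (a : Γ) (ha) (g : Γ) :
    cosetRightMul H a ha (g : Γ ⧸ H) = ((g * a : Γ) : Γ ⧸ H) :=
  rfl

theorem iterate_cosetRightMul_mk (H : Subgroup Γ) (a : Γ) (ha) (m : ℕ) (g : Γ) :
    (cosetRightMul H a ha)^[m] (g : Γ ⧸ H) = ((g * a ^ m : Γ) : Γ ⧸ H) := by
  induction m with
  | zero => simp
  | succ m ih => rw [Function.iterate_succ_apply', ih, cosetRightMul_mk, mul_assoc, pow_succ]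

variable {I : Type}

/-- Right multiplication on a disjoint union of coset spaces. -/
def sigmaRightMul (H : I → Subgroup Γ) (a : I → Γ) (ha : ∀ i, ∀ h ∈ H i, (a i)⁻¹ * h * a i ∈ H i) :
    (Σ i, Γ ⧸ H i) → Σ i, Γ ⧸ H i :=
  Sigma.map id fun i => cosetRightMul (H i) (a i) (ha i)

@[simp]
theorem sigmaRightMul_mk (H : I → Subgroup Γ) (a : I → Γ) (ha) (i : I) (q : Γ ⧸ H i) :
    sigmaRightMul H a ha ⟨i, q⟩ = ⟨i, cosetRightMul (H i) (a i) (ha i) q⟩ :=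
  rfl

theorem iterate_sigmaRightMul_mk (H : I → Subgroup Γ) (a : I → Γ) (ha) (m : ℕ) (i : I) (g : Γ) :
    (sigmaRightMul H a ha)^[m] ⟨i, (g : Γ ⧸ H i)⟩ = ⟨i, ((g * a i ^ m : Γ) : Γ ⧸ H i)⟩ := by
  rw [← iterate_cosetRightMul_mk (H i) (a i) (ha i)]
  induction m with
  | zero => rfl
  | succ m ih => rw [Function.iterate_succ_apply', ih, sigmaRightMul_mk,
      Function.iterate_succ_apply']

theorem sigmaRightMul_smul (H : I → Subgroup Γ) (a : I → Γ) (ha) (g : Γ) (x : Σ i, Γ ⧸ H i) :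
    sigmaRightMul H a ha (g • x) = g • sigmaRightMul H a ha x := by
  obtain ⟨i, q⟩ := x
  induction q using QuotientGroup.induction_on with
  | H z =>
    simp only [Sigma.smul_mk, sigmaRightMul_mk, cosetRightMul_mk, MulAction.Quotient.smul_coe,
      smul_eq_mul, mul_assoc]

theorem sigmaRightMul_injective (H : I → Subgroup Γ) (a : I → Γ) (ha)
    (ha' : ∀ i, ∀ h ∈ H i, a i * h * (a i)⁻¹ ∈ H i) :
    Function.Injective (sigmaRightMul H a ha) := by
  refine Function.LeftInverse.injective
    (g := sigmaRightMul H (fun i => (a i)⁻¹) fun i h hh => by simpa using ha' i h hh) ?_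
  rintro ⟨i, q⟩
  induction q using QuotientGroup.induction_on with
  | H z => simp

theorem iterate_sigmaRightMul_injective (H : I → Subgroup Γ) (a : I → Γ) (ha)
    (hord : ∀ i (m : ℕ), a i ^ m ∈ H i → m = 0) (x : Σ i, Γ ⧸ H i) :
    Function.Injective fun m : ℕ => (sigmaRightMul H a ha)^[m] x := by
  obtain ⟨i, q⟩ := x
  induction q using QuotientGroup.induction_on with
  | H z =>
    have key : ∀ m k : ℕ, ((z * a i ^ m : Γ) : Γ ⧸ H i) = ((z * a i ^ k : Γ) : Γ ⧸ H i) →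
        k ≤ m := fun m k h => by
      by_contra hlt
      have := hord i (k - m) (by
        rw [QuotientGroup.eq] at h
        convert h using 1
        obtain ⟨j, rfl⟩ : ∃ j, k = m + j := ⟨k - m, by omega⟩
        rw [Nat.add_sub_cancel_left, pow_add]
        group)
      omega
    intro m k h
    simp only [iterate_sigmaRightMul_mk, Sigma.mk.injEq, heq_eq_eq, true_and] at h
    exact le_antisymm (key k m h.symm) (key m k h)

/-- Adjoining to each `H i` a normalizing element of infinite order modulo `H i`. -/
theorem finiteHomology_permRep_sup_zpowers (H H' : I → Subgroup Γ) (a : I → Γ)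
    (ha : ∀ i, ∀ h ∈ H i, (a i)⁻¹ * h * a i ∈ H i)
    (ha' : ∀ i, ∀ h ∈ H i, a i * h * (a i)⁻¹ ∈ H i)
    (hord : ∀ i (m : ℕ), a i ^ m ∈ H i → m = 0)
    (hle : ∀ i, H i ≤ H' i) (haH : ∀ i, a i ∈ H' i)
    (hH' : ∀ i, ∀ g ∈ H' i, ∃ m : ℤ, ∃ h ∈ H i, g = a i ^ m * h)
    (hX : FiniteHomology (permRep Γ (Σ i, Γ ⧸ H i))) :
    FiniteHomology (permRep Γ (Σ i, Γ ⧸ H' i)) ∧ eulerChar (permRep Γ (Σ i, Γ ⧸ H' i)) = 0 := by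
  let p : (Σ i, Γ ⧸ H i) → Σ i, Γ ⧸ H' i := Sigma.map id fun i => Subgroup.quotientMapOfLE (hle i)
  have hp : ∀ i (g : Γ), p ⟨i, (g : Γ ⧸ H i)⟩ = ⟨i, (g : Γ ⧸ H' i)⟩ := fun i g => rfl
  refine finiteHomology_permRep_of_shift hX (sigmaRightMul_injective H a ha ha')
    (iterate_sigmaRightMul_injective H a ha hord) (sigmaRightMul_smul H a ha) (p := p) ?_ ?_ ?_ ?_
  · rintro g ⟨i, q⟩
    induction q using QuotientGroup.induction_on with
    | H z => rfl
  · rintro ⟨i, q⟩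
    induction q using QuotientGroup.induction_on with
    | H z =>
      rw [sigmaRightMul_mk, cosetRightMul_mk, hp, hp, Sigma.mk.injEq]
      refine ⟨rfl, heq_of_eq ?_⟩
      rw [eq_comm, QuotientGroup.eq]
      simpa using haH i
  · rintro ⟨i, q⟩ ⟨j, q'⟩ hpq
    obtain rfl : i = j := congrArg Sigma.fst hpq
    induction q using QuotientGroup.induction_on with
    | H z =>
    induction q' using QuotientGroup.induction_on with
    | H w =>
      rw [hp, hp, Sigma.mk.injEq] at hpq
      obtain ⟨m, h, hh, hm⟩ := hH' i _ (QuotientGroup.eq.1 (eq_of_heq hpq.2))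
      obtain ⟨k, rfl | rfl⟩ := m.eq_nat_or_neg
      · refine ⟨k, Or.inl ?_⟩
        rw [iterate_sigmaRightMul_mk, Sigma.mk.injEq]
        refine ⟨rfl, heq_of_eq (QuotientGroup.eq.2 ?_)⟩
        convert hh using 1
        rw [inv_mul_eq_iff_eq_mul] at hm
        rw [hm, zpow_natCast]
        group
      · refine ⟨k, Or.inr ?_⟩
        rw [iterate_sigmaRightMul_mk, Sigma.mk.injEq]
        refine ⟨rfl, heq_of_eq (QuotientGroup.eq.2 ?_)⟩
        -- For a negative exponent `w = z a⁻ᵏ h`, so the orbit runs from `w` to `z`, and `h` has to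
        -- be conjugated past `aᵏ`.
        have : ∀ n : ℕ, ∀ h ∈ H i, (a i ^ n)⁻¹ * h * a i ^ n ∈ H i := fun n => by
          induction n with
          | zero => simp
          | succ n ih =>
            intro h hh
            convert ha i _ (ih h hh) using 1
            rw [pow_succ]
            group
        convert this k _ (inv_mem hh) using 1
        rw [inv_mul_eq_iff_eq_mul] at hm
        rw [hm, zpow_neg, zpow_natCast]
        group
  · rintro ⟨i, q⟩
    induction q using QuotientGroup.induction_on with
    | H z => exact ⟨⟨i, z⟩, rfl⟩

end RightMul

end HantzscheWendt

namespace HantzscheWendt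

/-! ### The group `G_n`, its squares and its coordinate actions -/

variable {n : ℕ}

/-- The generator `x_i` of `G_n`. -/
def gen (i : Fin n) : G n := PresentedGroup.of i

theorem gen_relation {i j : Fin n} (h : i ≠ j) :
    (gen i)⁻¹ * gen j ^ 2 * gen i * gen j ^ 2 = 1 :=
  PresentedGroup.one_of_mem (rels := relators n) ⟨i, j, h, rfl⟩

theorem gen_induction {P : G n → Prop} (one : P 1) (gen : ∀ i, P (gen i))
    (mul : ∀ g h, P g → P h → P (g * h)) (inv : ∀ g, P g → P g⁻¹) (g : G n) : P g := by
  have hg : g ∈ Subgroup.closure (Set.range (PresentedGroup.of (rels := relators n))) := by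
    rw [PresentedGroup.closure_range_of]; trivial
  induction hg using Subgroup.closure_induction with
  | mem x hx => obtain ⟨i, rfl⟩ := hx; exact gen i
  | one => exact one
  | mul x y _ _ hx hy => exact mul x y hx hy
  | inv x _ hx => exact inv x hx

/-- A homomorphism out of `G_n` from elements satisfying the relations. -/
def liftHom {K : Type*} [Group K] (f : Fin n → K)
    (hf : ∀ i j, i ≠ j → (f i)⁻¹ * f j ^ 2 * f i * f j ^ 2 = 1) : G n →* K :=
  PresentedGroup.toGroup (f := f) (rels := relators n) (by
    rintro _ ⟨i, j, hij, rfl⟩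
    simpa using hf i j hij)

@[simp]
theorem liftHom_gen {K : Type*} [Group K] (f : Fin n → K) (hf) (i : Fin n) :
    liftHom f hf (gen i) = f i :=
  PresentedGroup.toGroup.of _

/-- A generator `x_i` centralizes `x_j²` if `i = j` and inverts it otherwise; both properties pass
to products and inverses. This makes every `sqSubgroup S` normal. -/
theorem conj_gen_sq (g : G n) (j : Fin n) :
    g * gen j ^ 2 * g⁻¹ = gen j ^ 2 ∨ g * gen j ^ 2 * g⁻¹ = (gen j ^ 2)⁻¹ := by
  induction g using gen_induction with
  | one => simp
  | gen i =>
    by_cases h : i = j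
    · subst h; left; group
    · right
      have h1 : (gen i)⁻¹ * gen j ^ 2 * gen i = (gen j ^ 2)⁻¹ :=
        eq_inv_of_mul_eq_one_left (gen_relation h)
      have h2 : gen i * (gen j ^ 2)⁻¹ * (gen i)⁻¹ = gen j ^ 2 := by
        rw [← h1]; group
      calc gen i * gen j ^ 2 * (gen i)⁻¹ = (gen i * (gen j ^ 2)⁻¹ * (gen i)⁻¹)⁻¹ := by group
        _ = (gen j ^ 2)⁻¹ := by rw [h2]
  | mul g h hg hh =>
    have e : g * h * gen j ^ 2 * (g * h)⁻¹ = g * (h * gen j ^ 2 * h⁻¹) * g⁻¹ := by group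
    have e' : g * (gen j ^ 2)⁻¹ * g⁻¹ = (g * gen j ^ 2 * g⁻¹)⁻¹ := by group
    rw [e]
    rcases hh with hh | hh <;> rw [hh]
    · exact hg
    · rw [e']
      rcases hg with hg | hg <;> rw [hg]
      · exact Or.inr rfl
      · exact Or.inl (inv_inv _)
  | inv g hg =>
    rcases hg with hg | hg
    · left
      conv_lhs => rw [← hg]
      group
    · right
      have : g⁻¹ * (g * gen j ^ 2 * g⁻¹)⁻¹ * g⁻¹⁻¹ = (gen j ^ 2)⁻¹ := by group
      rw [← this, hg]
      simp only [inv_inv]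

/-- The subgroup generated by the squares `x_i²` with `i ∈ S`. -/
def sqSubgroup (S : Finset (Fin n)) : Subgroup (G n) :=
  Subgroup.closure ((fun i => gen i ^ 2) '' S)

theorem gen_sq_mem {S : Finset (Fin n)} {i : Fin n} (h : i ∈ S) : gen i ^ 2 ∈ sqSubgroup S :=
  Subgroup.subset_closure ⟨i, h, rfl⟩

theorem sqSubgroup_le {S : Finset (Fin n)} {K : Subgroup (G n)}
    (h : ∀ i ∈ S, gen i ^ 2 ∈ K) : sqSubgroup S ≤ K := by
  refine (Subgroup.closure_le _).2 ?_
  rintro _ ⟨i, hi, rfl⟩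
  exact h i hi

theorem sqSubgroup_mono {S T : Finset (Fin n)} (h : S ⊆ T) : sqSubgroup S ≤ sqSubgroup T :=
  sqSubgroup_le fun _ hi => gen_sq_mem (h hi)

instance sqSubgroup_normal (S : Finset (Fin n)) : (sqSubgroup S).Normal where
  conj_mem h hh g := by
    have : sqSubgroup S ≤ (sqSubgroup S).comap (MulAut.conj g).toMonoidHom :=
      sqSubgroup_le fun i hi => by
        change g * gen i ^ 2 * g⁻¹ ∈ sqSubgroup S
        rcases conj_gen_sq g i with e | e <;> rw [e]
        exacts [gen_sq_mem hi, inv_mem (gen_sq_mem hi)]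
    exact this hh

theorem sqSubgroup_conj_mem (S : Finset (Fin n)) (a : G n) :
    ∀ h ∈ sqSubgroup S, a * h * a⁻¹ ∈ sqSubgroup S :=
  fun h hh => (sqSubgroup_normal S).conj_mem h hh a

theorem sqSubgroup_conj_mem' (S : Finset (Fin n)) (a : G n) :
    ∀ h ∈ sqSubgroup S, a⁻¹ * h * a ∈ sqSubgroup S :=
  fun h hh => by simpa using (sqSubgroup_normal S).conj_mem h hh a⁻¹

/-- The action of `G_n` on the `k`-th coordinate: `x_k` translates and the other generators act
by a reflection. -/
def coordHom (k : Fin n) : G n →* Equiv.Perm ℤ :=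
  liftHom (fun i => if i = k then Equiv.addRight 1 else Equiv.neg ℤ) fun i j hij => by
    by_cases hj : j = k
    · subst hj
      ext m
      simp [hij, pow_two, Equiv.Perm.mul_apply]
    · have : (Equiv.neg ℤ) ^ 2 = (1 : Equiv.Perm ℤ) := by ext m; simp [pow_two]
      simp only [if_neg hj, this, mul_one, inv_mul_cancel]

theorem coordHom_gen_self_pow (k : Fin n) (m : ℕ) (z : ℤ) :
    coordHom k (gen k ^ m) z = z + m := by
  induction m generalizing z with
  | zero => simp
  | succ m ih =>
    rw [pow_succ, map_mul, Equiv.Perm.mul_apply, ih]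
    simp [coordHom]
    ring

theorem coordHom_gen_of_ne {i k : Fin n} (h : i ≠ k) : coordHom k (gen i) = Equiv.neg ℤ := by
  simp [coordHom, h]

theorem sqSubgroup_le_ker_coordHom {S : Finset (Fin n)} {k : Fin n} (h : k ∉ S) :
    sqSubgroup S ≤ (coordHom k).ker :=
  sqSubgroup_le fun i hi => by
    rw [MonoidHom.mem_ker, map_pow, coordHom_gen_of_ne (ne_of_mem_of_not_mem hi h)]
    ext m
    simp [pow_two]

/-- On the `k`-th coordinate `x_k` is a unit translation, while the squares of the other generators
act trivially. This independence is all that is needed in place of `A` being free abelian. -/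
theorem eq_zero_of_gen_pow_mem {S : Finset (Fin n)} {k : Fin n} (h : k ∉ S) {m : ℕ}
    (hm : gen k ^ m ∈ sqSubgroup S) : m = 0 := by
  have h1 := coordHom_gen_self_pow k m 0
  rw [MonoidHom.mem_ker.1 (sqSubgroup_le_ker_coordHom h hm)] at h1
  simpa [eq_comm] using h1

theorem exists_zpow_mul_of_mem_sqSubgroup {S : Finset (Fin n)} {k : Fin n} {g : G n}
    (hg : g ∈ sqSubgroup S) :
    ∃ m : ℤ, ∃ h ∈ sqSubgroup (S.erase k), g = (gen k ^ 2) ^ m * h := by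
  have : sqSubgroup S ≤ Subgroup.zpowers (gen k ^ 2) ⊔ sqSubgroup (S.erase k) :=
    sqSubgroup_le fun i hi => by
      by_cases h : i = k
      · subst h
        exact Subgroup.mem_sup_left (Subgroup.mem_zpowers _)
      · exact Subgroup.mem_sup_right (gen_sq_mem (Finset.mem_erase.2 ⟨h, hi⟩))
  obtain ⟨_, ⟨m, rfl⟩, z, hz, rfl⟩ := Subgroup.mem_sup_of_normal_right.1 (this hg)
  exact ⟨m, z, hz, rfl⟩

/-- Induction on the number of squares: without squares the module is free, and each further square
is adjoined by one shift. Families are allowed because `EdgeSet` is a union over `j`. -/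
theorem finiteHomology_permRep_sqSubgroup {I : Type} [Finite I] (k : ℕ) (S : I → Finset (Fin n))
    (hS : ∀ i, (S i).card = k) :
    FiniteHomology (permRep (G n) (Σ i, G n ⧸ sqSubgroup (S i))) ∧
      (0 < k → eulerChar (permRep (G n) (Σ i, G n ⧸ sqSubgroup (S i))) = 0) := by
  induction k generalizing S with
  | zero =>
    refine ⟨?_, fun h => absurd h (lt_irrefl _)⟩
    have hbot : ∀ i, sqSubgroup (S i) = ⊥ := fun i => by
      rw [Finset.card_eq_zero.1 (hS i)]
      simp [sqSubgroup]
    refine finiteHomology_permRep_of_free (I := I) (fun i => ⟨i, ((1 : G n) : G n ⧸ _)⟩) ⟨?_, ?_⟩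
    · rintro ⟨i, g⟩ ⟨j, h⟩ e
      obtain rfl : i = j := congrArg Sigma.fst e
      simp only [Sigma.smul_mk, Sigma.mk.injEq, heq_eq_eq, true_and, MulAction.Quotient.smul_coe,
        smul_eq_mul, mul_one] at e
      rw [QuotientGroup.eq, hbot, Subgroup.mem_bot, inv_mul_eq_one] at e
      rw [e]
    · rintro ⟨i, q⟩
      induction q using QuotientGroup.induction_on with
      | H z => exact ⟨(i, z), by simp only [Sigma.smul_mk, MulAction.Quotient.smul_coe, smul_eq_mul, mul_one]⟩
  | succ k ih =>
    have hne : ∀ i, ∃ s, s ∈ S i := fun i => Finset.card_pos.1 (by rw [hS]; omega)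
    choose s hs using hne
    have := finiteHomology_permRep_sup_zpowers (fun i => sqSubgroup ((S i).erase (s i)))
      (fun i => sqSubgroup (S i)) (fun i => gen (s i) ^ 2)
      (fun i => sqSubgroup_conj_mem' _ _) (fun i => sqSubgroup_conj_mem _ _)
      (fun i m hm => by
        rw [← pow_mul] at hm
        have := eq_zero_of_gen_pow_mem (Finset.notMem_erase _ _) hm
        omega)
      (fun i => sqSubgroup_mono (Finset.erase_subset _ _)) (fun i => gen_sq_mem (hs i))
      (fun i g hg => exists_zpow_mul_of_mem_sqSubgroup hg)
      (ih _ fun i => by rw [Finset.card_erase_of_mem (hs i), hS, Nat.add_sub_cancel]).1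
    exact ⟨this.1, fun _ => this.2⟩

/-! ### The edge module -/

/-- The disjoint union over `j` of the coset spaces of the subgroups `⟨x_i² : i ≠ j⟩`. -/
abbrev EdgeSet (n : ℕ) : Type := Σ j : Fin n, G n ⧸ sqSubgroup (Finset.univ.erase j)

/-- Right multiplication by `x_j` on the `j`-th component. -/
def edgeShift : EdgeSet n → EdgeSet n :=
  sigmaRightMul (fun j => sqSubgroup (Finset.univ.erase j)) gen
    (fun j => sqSubgroup_conj_mem' _ (gen j))

/-- The coset of `g` in the `j`-th component. -/
def edge (j : Fin n) (g : G n) : EdgeSet n := ⟨j, g⟩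

theorem edgeShift_edge (j : Fin n) (g : G n) : edgeShift (edge j g) = edge j (g * gen j) := rfl

theorem edge_surjective (x : EdgeSet n) : ∃ j g, x = edge j g := by
  obtain ⟨j, q⟩ := x
  induction q using QuotientGroup.induction_on with
  | H z => exact ⟨j, z, rfl⟩

theorem edgeShift_smul (g : G n) (x : EdgeSet n) : edgeShift (g • x) = g • edgeShift x :=
  sigmaRightMul_smul _ _ _ g x

variable (n) in
/-- The quotient of the permutation module on `EdgeSet n` in which right multiplication by `x_j`
acts as `-1`. -/
noncomputable def edgeRep : Rep.{0} ℚ (G n) :=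
  Rep.quotient (permRep (G n) (EdgeSet n)) (LinearMap.range (shiftSub (edgeShift (n := n)) (-1)))
    (by
      rintro g _ ⟨u, rfl⟩
      exact ⟨permRepresentation (G n) (EdgeSet n) g u,
        Rep.hom_comm_apply (shiftSubHom edgeShift edgeShift_smul (-1)) g u⟩)

/-- The projection onto `edgeRep n`. -/
noncomputable def edgeProj : permRep (G n) (EdgeSet n) ⟶ edgeRep n :=
  Rep.mkQ _ _ _

theorem edgeProj_eq_zero_iff (v : EdgeSet n →₀ ℚ) :
    edgeProj.hom v = 0 ↔ ∃ u, shiftSub edgeShift (-1) u = v :=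
  Submodule.Quotient.mk_eq_zero _

theorem edgeProj_surjective : Function.Surjective (edgeProj (n := n)).hom :=
  Submodule.mkQ_surjective _

/-- Here the shift is by `x_j` itself rather than its square, with `c = -1`; `x_j` has infinite
order modulo the other squares. -/
theorem edgeRep_finiteHomology : FiniteHomology (edgeRep n) ∧ eulerChar (edgeRep n) = 0 :=
  finiteHomology_of_shift (finiteHomology_permRep_sqSubgroup (n - 1) _ fun j => by
      rw [Finset.card_erase_of_mem (Finset.mem_univ j), Finset.card_univ, Fintype.card_fin]).1
    (sigmaRightMul_injective _ _ _ fun j => sqSubgroup_conj_mem _ (gen j))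
    (iterate_sigmaRightMul_injective _ _ _ fun j _ hm =>
      eq_zero_of_gen_pow_mem (Finset.notMem_erase j _) hm)
    edgeShift_smul (-1) edgeProj edgeProj_surjective edgeProj_eq_zero_iff

/-- The class of the coset of `g` in the `j`-th summand of `edgeRep n`. -/
noncomputable def edgeVec (j : Fin n) (g : G n) : edgeRep n :=
  edgeProj.hom (Finsupp.single (edge j g) (1 : ℚ))

theorem edgeRep_ρ_edgeVec (h : G n) (j : Fin n) (g : G n) :
    (edgeRep n).ρ h (edgeVec j g) = edgeVec j (h * g) :=
  (Rep.hom_comm_apply edgeProj h _).symm.trans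
    (congrArg edgeProj.hom (permRepresentation_single h (edge j g) 1))

theorem edgeVec_mul_gen (j : Fin n) (g : G n) : edgeVec j (g * gen j) = -edgeVec j g := by
  rw [eq_neg_iff_add_eq_zero, edgeVec, edgeVec, ← map_add]
  refine (edgeProj_eq_zero_iff _).2 ⟨Finsupp.single (edge j g) 1, ?_⟩
  rw [shiftSub_single, edgeShift_edge, neg_one_smul, sub_neg_eq_add]

theorem edgeRep_hom_ext {V : Type*} [AddCommGroup V] [Module ℚ V] {f f' : edgeRep n →ₗ[ℚ] V}
    (h : ∀ j g, f (edgeVec j g) = f' (edgeVec j g)) : f = f' := by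
  refine LinearMap.ext fun x => ?_
  obtain ⟨v, rfl⟩ := edgeProj_surjective x
  have : f ∘ₗ edgeProj.hom.toLinearMap = f' ∘ₗ edgeProj.hom.toLinearMap :=
    Finsupp.lhom_ext' fun x => LinearMap.ext_ring <| by
      obtain ⟨j, g, rfl⟩ := edge_surjective x
      exact h j g
  exact LinearMap.congr_fun this v

/-- The squares `x_i²` with `i ≠ j` are absorbed by the coset, and `x_j²` acts as `(-1)² = 1`. -/
theorem edgeVec_mul_of_mem (j : Fin n) (g : G n) {a : G n}
    (ha : a ∈ sqSubgroup (Finset.univ : Finset (Fin n))) : edgeVec j (g * a) = edgeVec j g := by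
  obtain ⟨m, h, hh, rfl⟩ := exists_zpow_mul_of_mem_sqSubgroup (k := j) ha
  have h1 : ∀ g, edgeVec j (g * gen j ^ 2) = edgeVec j g := fun g => by
    rw [pow_two, ← mul_assoc, edgeVec_mul_gen, edgeVec_mul_gen, neg_neg]
  have h2 : ∀ g, edgeVec j (g * h) = edgeVec j g := fun g => by
    have : edge j (g * h) = edge j g := by
      refine Sigma.ext rfl (heq_of_eq (QuotientGroup.eq.2 ?_))
      simpa using inv_mem hh
    rw [edgeVec, this, edgeVec]
  rw [← mul_assoc, h2]
  clear ha
  induction m with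
  | zero => simp
  | succ m ih => rw [zpow_add_one, ← mul_assoc, h1, ih]
  | pred m ih => rw [← h1, mul_assoc, ← zpow_add_one, sub_add_cancel, ih]

theorem edgeRep_ρ_of_mem {a : G n} (ha : a ∈ sqSubgroup (Finset.univ : Finset (Fin n))) :
    (edgeRep n).ρ a = LinearMap.id := by
  refine edgeRep_hom_ext fun j g => ?_
  have : a * g = g * (g⁻¹ * a * g) := by group
  rw [edgeRep_ρ_edgeVec, this, edgeVec_mul_of_mem j g (sqSubgroup_conj_mem' _ _ _ ha)]
  rfl

/-! ### The derivation and the exact sequence -/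

/-- The affine action of `x_j` on `edgeRep n`. -/
noncomputable def affineGen (j : Fin n) : Equiv.Perm (edgeRep n) where
  toFun m := (edgeRep n).ρ (gen j) m + edgeVec j 1
  invFun m := (edgeRep n).ρ (gen j)⁻¹ (m - edgeVec j 1)
  left_inv m := by simp
  right_inv m := by simp

/-- With `e` the class of `1` in summand `j`, the square adds `x_j e + e`, which vanishes because
`x_j e = -e`. All relators then hold at once. -/
theorem affineGen_sq (j : Fin n) : affineGen j ^ 2 = 1 := by
  ext m
  have : (edgeRep n).ρ (gen j) ((edgeRep n).ρ (gen j) m) = m := by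
    have := LinearMap.congr_fun (edgeRep_ρ_of_mem (gen_sq_mem (Finset.mem_univ j))) m
    rwa [pow_two, map_mul] at this
  have h2 : (edgeRep n).ρ (gen j) (edgeVec j 1) = -edgeVec j 1 := by
    rw [edgeRep_ρ_edgeVec, mul_one, ← edgeVec_mul_gen, one_mul]
  change (edgeRep n).ρ (gen j) ((edgeRep n).ρ (gen j) m + edgeVec j 1) + edgeVec j 1 = m
  rw [map_add, this, h2, neg_add_cancel_right]

/-- The affine action of `G_n` on `edgeRep n`. -/
noncomputable def affineAction : G n →* Equiv.Perm (edgeRep n) :=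
  liftHom affineGen fun i j _ => by simp [affineGen_sq]

/-- The derivation of `G_n` into `edgeRep n` which maps `x_j` to the class of `1` in the `j`-th
summand. -/
noncomputable def derivation (g : G n) : edgeRep n := affineAction g 0

theorem affineAction_apply (g : G n) (m : edgeRep n) :
    affineAction g m = (edgeRep n).ρ g m + derivation g := by
  induction g using gen_induction generalizing m with
  | one => simp [derivation]
  | gen i => simp [derivation, affineAction, affineGen]
  | mul g h hg hh =>
    rw [derivation, map_mul, Equiv.Perm.mul_apply, Equiv.Perm.mul_apply, hg, hh, hg, hh, map_mul]
    simp [add_assoc]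
  | inv g hg =>
    have key : ∀ m, affineAction g⁻¹ m = (edgeRep n).ρ g⁻¹ (m - derivation g) := fun m => by
      rw [map_inv, Equiv.Perm.inv_eq_iff_eq, hg]
      simp
    rw [derivation, key, key]
    simp [sub_eq_add_neg]

theorem derivation_mul (g h : G n) :
    derivation (g * h) = (edgeRep n).ρ g (derivation h) + derivation g := by
  rw [← affineAction_apply, derivation, map_mul]
  rfl

theorem derivation_gen (j : Fin n) : derivation (gen j) = edgeVec j 1 := by
  simp [derivation, affineAction, affineGen]

theorem derivation_of_mem {a : G n} (ha : a ∈ sqSubgroup (Finset.univ : Finset (Fin n))) :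
    derivation a = 0 := by
  have : sqSubgroup (Finset.univ : Finset (Fin n)) ≤ affineAction.ker :=
    sqSubgroup_le fun i _ => by
      rw [MonoidHom.mem_ker, affineAction, map_pow, liftHom_gen, affineGen_sq]
  rw [derivation, MonoidHom.mem_ker.1 (this ha)]
  rfl

variable (n) in
/-- The quotient of `G_n` by the subgroup generated by all squares of generators. -/
abbrev VertexSet : Type := G n ⧸ sqSubgroup (Finset.univ : Finset (Fin n))

/-- The linear extension of the derivation. -/
noncomputable def derivationLin : (VertexSet n →₀ ℚ) →ₗ[ℚ] edgeRep n :=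
  Finsupp.linearCombination ℚ fun q => Quotient.liftOn' q derivation fun g h hgh => by
    rw [QuotientGroup.leftRel_apply] at hgh
    rw [← mul_inv_cancel_left g h, derivation_mul, derivation_of_mem hgh, map_zero, zero_add]

theorem derivationLin_single (g : G n) (r : ℚ) :
    derivationLin (Finsupp.single (g : VertexSet n) r) = r • derivation g :=
  Finsupp.linearCombination_single _ _ _

/-- The boundary map `[g]_j ↦ [g x_j] - [g]` on the permutation module. -/
noncomputable def boundaryLin : (EdgeSet n →₀ ℚ) →ₗ[ℚ] (VertexSet n →₀ ℚ) :=
  Finsupp.linearCombination ℚ fun x =>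
    Finsupp.single (cosetRightMul _ (gen x.1) (sqSubgroup_conj_mem' _ (gen x.1))
      (Subgroup.quotientMapOfLE (sqSubgroup_mono (Finset.erase_subset _ _)) x.2)) 1 -
    Finsupp.single (Subgroup.quotientMapOfLE (sqSubgroup_mono (Finset.erase_subset _ _)) x.2) 1

theorem boundaryLin_single (j : Fin n) (g : G n) :
    boundaryLin (Finsupp.single (edge j g) 1) =
      Finsupp.single ((g * gen j : G n) : VertexSet n) 1 - Finsupp.single (g : VertexSet n) 1 :=
  (Finsupp.linearCombination_single _ _ _).trans (one_smul _ _)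

/-- The boundaries of `[g]_j` and `[g x_j]_j` cancel, since `g x_j²` and `g` are the same vertex. -/
theorem range_shiftSub_le_ker_boundaryLin :
    LinearMap.range (shiftSub (edgeShift (n := n)) (-1)) ≤ LinearMap.ker boundaryLin := by
  rintro _ ⟨u, rfl⟩
  have : boundaryLin ∘ₗ shiftSub (edgeShift (n := n)) (-1) = 0 :=
    Finsupp.lhom_ext' fun x => LinearMap.ext_ring <| by
      obtain ⟨j, g, rfl⟩ := edge_surjective x
      rw [LinearMap.comp_apply, LinearMap.comp_apply, Finsupp.lsingle_apply, shiftSub_single,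
        edgeShift_edge, map_sub, map_smul, boundaryLin_single, boundaryLin_single]
      have : ((g * gen j * gen j : G n) : VertexSet n) = (g : VertexSet n) := by
        rw [eq_comm, QuotientGroup.eq]
        convert gen_sq_mem (Finset.mem_univ j) using 1
        rw [pow_two]
        group
      rw [this]
      simp
  exact LinearMap.congr_fun this u

/-- The boundary map on `edgeRep n` as a linear map. -/
noncomputable def boundaryQuot : edgeRep n →ₗ[ℚ] (VertexSet n →₀ ℚ) :=
  Submodule.liftQ _ boundaryLin range_shiftSub_le_ker_boundaryLin

theorem boundaryQuot_edgeVec (j : Fin n) (g : G n) :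
    boundaryQuot (edgeVec j g) =
      Finsupp.single ((g * gen j : G n) : VertexSet n) 1 - Finsupp.single (g : VertexSet n) 1 :=
  boundaryLin_single j g

/-- The boundary map `edgeRep n ⟶ ℚ[G_n / A]`. -/
noncomputable def boundary : edgeRep n ⟶ permRep (G n) (VertexSet n) :=
  Rep.ofHom (ρ := (edgeRep n).ρ) (σ := permRepresentation (G n) (VertexSet n))
    ⟨boundaryQuot, fun g => by
      refine edgeRep_hom_ext fun j h => ?_
      rw [LinearMap.comp_apply, LinearMap.comp_apply, edgeRep_ρ_edgeVec, boundaryQuot_edgeVec,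
        boundaryQuot_edgeVec, map_sub, permRepresentation_single,
        permRepresentation_single, MulAction.Quotient.smul_coe, MulAction.Quotient.smul_coe,
        smul_eq_mul, smul_eq_mul, mul_assoc]⟩

theorem boundary_edgeVec (j : Fin n) (g : G n) :
    boundary.hom (edgeVec j g) =
      Finsupp.single ((g * gen j : G n) : VertexSet n) (1 : ℚ) -
        Finsupp.single (g : VertexSet n) (1 : ℚ) :=
  boundaryQuot_edgeVec j g

/-- The derivation `D` gives a left inverse: `D (g x_j) - D g = g • D x_j`, which is the edge vector
at `g`. -/
theorem boundary_injective : Function.Injective (boundary (n := n)).hom := by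
  have : derivationLin ∘ₗ (boundary (n := n)).hom.toLinearMap = LinearMap.id := by
    refine edgeRep_hom_ext fun j g => ?_
    change derivationLin (boundary.hom (edgeVec j g)) = edgeVec j g
    rw [boundary_edgeVec, map_sub, derivationLin_single, derivationLin_single, derivation_mul,
      derivation_gen, edgeRep_ρ_edgeVec]
    simp
  exact Function.LeftInverse.injective (g := derivationLin) fun x => LinearMap.congr_fun this x

/-- Fox's fundamental formula: both sides are derivations in `g` that agree on generators. -/
theorem boundary_derivation (g : G n) :
    boundary.hom (derivation g) =
      Finsupp.single (g : VertexSet n) (1 : ℚ) - Finsupp.single ((1 : G n) : VertexSet n) (1 : ℚ) := by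
  have hρ : ∀ g h : G n, boundary.hom ((edgeRep n).ρ g (derivation h)) =
      permRepresentation (G n) (VertexSet n) g (boundary.hom (derivation h)) := fun g h =>
    Rep.hom_comm_apply boundary g _
  have hs : ∀ g h : G n, permRepresentation (G n) (VertexSet n) g
      (Finsupp.single (h : VertexSet n) 1) = Finsupp.single ((g * h : G n) : VertexSet n) 1 :=
    fun g h => permRepresentation_single g _ _
  have h1 : derivation (1 : G n) = 0 := derivation_of_mem (one_mem _)
  induction g using gen_induction with
  | one => rw [h1, map_zero, sub_self]
  | gen i => rw [derivation_gen, boundary_edgeVec, one_mul]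
  | mul g h hg hh =>
    rw [derivation_mul, map_add, hρ, hh, hg, map_sub, hs, hs, mul_one, sub_add_sub_cancel]
  | inv g hg =>
    have e := derivation_mul g⁻¹ g
    rw [inv_mul_cancel, h1, eq_comm, add_comm, ← eq_neg_iff_add_eq_zero] at e
    rw [e, map_neg, hρ, hg, map_sub, hs, hs, inv_mul_cancel, mul_one, neg_sub]

/-- The augmentation `ℚ[G_n / A] ⟶ ℚ`. -/
noncomputable def augmentation : permRep (G n) (VertexSet n) ⟶ Rep.trivial ℚ (G n) ℚ :=
  permRepHom (Finsupp.linearCombination ℚ fun _ => (1 : ℚ)) fun g x => by simp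

theorem augmentation_surjective : Function.Surjective (augmentation (n := n)).hom := fun r =>
  ⟨Finsupp.single ((1 : G n) : VertexSet n) r,
    (Finsupp.linearCombination_single _ _ _).trans (mul_one r)⟩

/-- The contracting homotopy is `v = ∂ (D v) + ε(v) [1]`, with `D` the linear extension of the
derivation. -/
theorem augmentation_eq_zero_iff (v : VertexSet n →₀ ℚ) :
    augmentation.hom v = 0 ↔ ∃ m, boundary.hom m = v := by
  constructor
  · intro hv
    refine ⟨derivationLin v, ?_⟩
    have : (boundary (n := n)).hom.toLinearMap ∘ₗ derivationLin = LinearMap.id -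
        (Finsupp.lsingle ((1 : G n) : VertexSet n)) ∘ₗ
          Finsupp.linearCombination ℚ fun _ : VertexSet n => (1 : ℚ) :=
      Finsupp.lhom_ext' fun q => LinearMap.ext_ring <| by
        induction q using QuotientGroup.induction_on with
        | H g =>
          change boundary.hom (derivationLin (Finsupp.single (g : VertexSet n) 1)) = _
          rw [derivationLin_single, one_smul, boundary_derivation]
          simp
    have e := LinearMap.congr_fun this v
    have hv' : (Finsupp.linearCombination ℚ fun _ : VertexSet n => (1 : ℚ)) v = 0 := hv
    simpa [hv'] using e
  · rintro ⟨m, rfl⟩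
    have : (augmentation (n := n)).hom.toLinearMap ∘ₗ (boundary (n := n)).hom.toLinearMap = 0 := by
      refine edgeRep_hom_ext fun j g => ?_
      change augmentation.hom (boundary.hom (edgeVec j g)) = 0
      rw [boundary_edgeVec]
      change (Finsupp.linearCombination ℚ fun _ : VertexSet n => (1 : ℚ)) _ = 0
      simp
    exact LinearMap.congr_fun this m

theorem finiteHomology_vertexSet :
    FiniteHomology (permRep (G n) (VertexSet n)) ∧
      (0 < n → eulerChar (permRep (G n) (VertexSet n)) = 0) := by
  have h := finiteHomology_permRep_sqSubgroup (I := Unit) n (fun _ => Finset.univ)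
    fun _ => by rw [Finset.card_univ, Fintype.card_fin]
  let p : (Σ _ : Unit, VertexSet n) ≃ VertexSet n := Equiv.uniqueSigma _
  let φ : permRep (G n) (Σ _ : Unit, VertexSet n) ⟶ permRep (G n) (VertexSet n) :=
    permRepHom (Finsupp.lmapDomain ℚ ℚ p) fun g x => by simp; rfl
  obtain ⟨e⟩ := nonempty_iso_of_bijective φ
    ⟨Finsupp.mapDomain_injective p.injective, Finsupp.mapDomain_surjective p.surjective⟩
  exact ⟨h.1.of_iso e, fun hn => (eulerChar_congr e).symm.trans (h.2 hn)⟩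

theorem hasFiniteRationalHomology_and_eulerCharacteristic (hn : 1 ≤ n) :
    HasFiniteRationalHomology (G n) ∧ eulerCharacteristic (G n) = 0 := by
  obtain ⟨h1, h2⟩ := finiteHomology_of_linear boundary augmentation boundary_injective
    augmentation_surjective augmentation_eq_zero_iff edgeRep_finiteHomology.1
    (finiteHomology_vertexSet (n := n)).1
  refine ⟨h1, h2.trans ?_⟩
  rw [finiteHomology_vertexSet.2 hn, edgeRep_finiteHomology.2, sub_zero]

/-! ### Abelianization and first Betti number -/

section Abelianization

/-- The homomorphism `G_n → (ℤ/4)^n` mapping the generators to the standard basis. -/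
def toZModFour : G n →* Multiplicative (Fin n → ZMod 4) :=
  liftHom (fun i => Multiplicative.ofAdd (Pi.single i 1)) fun i j _ => by
    rw [inv_mul_cancel_comm, ← pow_add, ← ofAdd_nsmul, ← ofAdd_zero]
    congr 1
    rw [← Pi.single_smul]
    simp only [Nat.reduceAdd, nsmul_eq_mul, mul_one]
    rw [show ((4 : ℕ) : ZMod 4) = 0 from by decide, Pi.single_zero]

theorem toZModFour_gen (i : Fin n) :
    toZModFour (gen i) = Multiplicative.ofAdd (Pi.single i 1) :=
  liftHom_gen _ _ _

theorem abelianization_gen_pow_four (hn : 1 < n) (i : Fin n) :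
    Abelianization.of (gen i) ^ 4 = 1 := by
  have : Nontrivial (Fin n) := Fin.nontrivial_iff_two_le.2 hn
  obtain ⟨j, hj⟩ := exists_ne i
  have := congrArg Abelianization.of (gen_relation hj)
  simp only [map_mul, map_inv, map_pow, map_one] at this
  rw [inv_mul_cancel_comm, ← pow_add] at this
  exact this

/-- The homomorphism `(ℤ/4)^n → G_n^ab` inverse to `toZModFour`. -/
noncomputable def ofZModFour (hn : 1 < n) :
    (Fin n → ZMod 4) →+ Additive (Abelianization (G n)) :=
  ∑ i, (ZMod.lift 4 ⟨zmultiplesHom _ (Additive.ofMul (Abelianization.of (gen i))),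
    congrArg Additive.ofMul (abelianization_gen_pow_four hn i)⟩).comp (Pi.evalAddMonoidHom _ i)

theorem ofZModFour_single (hn : 1 < n) (i : Fin n) :
    ofZModFour hn (Pi.single i 1) = Additive.ofMul (Abelianization.of (gen i)) := by
  rw [ofZModFour, AddMonoidHom.finsetSum_apply, Finset.sum_eq_single i]
  · have := ZMod.lift_coe 4 (⟨zmultiplesHom _ (Additive.ofMul (Abelianization.of (gen i))),
      congrArg Additive.ofMul (abelianization_gen_pow_four hn i)⟩ :
        { f : ℤ →+ Additive (Abelianization (G n)) // f (4 : ℕ) = 0 }) 1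
    simpa using this
  · intro j _ hj
    simp [Pi.single_eq_of_ne hj]
  · simp

/-- The abelianization of `G_n` is `(ℤ/4)^n`. -/
noncomputable def abelianizationEquiv (hn : 1 < n) :
    Abelianization (G n) ≃* Multiplicative (Fin n → ZMod 4) :=
  MonoidHom.toMulEquiv (Abelianization.lift toZModFour)
    (AddMonoidHom.toMultiplicativeLeft (ofZModFour hn))
    (by
      refine Abelianization.hom_ext _ _ (PresentedGroup.ext fun i => ?_)
      change ofZModFour hn (toZModFour (gen i)).toAdd = _
      rw [toZModFour_gen, toAdd_ofAdd, ofZModFour_single]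
      rfl)
    (by
      have : (MonoidHom.toAdditiveLeft (Abelianization.lift toZModFour)).comp (ofZModFour hn) =
          AddMonoidHom.id _ := by
        refine AddMonoidHom.functions_ext' _ _ _ fun i => AddMonoidHom.ext fun x => ?_
        obtain ⟨k, rfl⟩ := ZMod.intCast_surjective x
        have h1 : (MonoidHom.toAdditiveLeft (Abelianization.lift (toZModFour (n := n))))
            (ofZModFour hn (Pi.single i 1)) = Pi.single i 1 := by
          rw [ofZModFour_single]
          exact toZModFour_gen i
        rw [← zsmul_one, map_zsmul, map_zsmul]
        exact congrArg (k • ·) h1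
      exact MonoidHom.ext fun v => DFunLike.congr_fun this v.toAdd)

theorem bettiNumber_one (hn : 1 < n) : bettiNumber (G n) 1 = 0 := by
  have h4 : ∀ a : Additive (Abelianization (G n)), (4 : ℤ) • a = 0 := fun a => by
    apply (abelianizationEquiv hn).toAdditive.injective
    rw [map_zsmul, map_zero]
    refine funext fun i => ?_
    have : ∀ x : ZMod 4, (4 : ℤ) • x = 0 := by decide
    exact this _
  have : Subsingleton (TensorProduct ℤ (Additive (Abelianization (G n))) ℚ) := by
    refine subsingleton_of_forall_eq 0 fun x => ?_
    induction x with
    | zero => rfl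
    | add x y hx hy => rw [hx, hy, add_zero]
    | tmul a q =>
      -- Divisibility of `ℚ` moves the factor `4` onto the torsion side.
      have : q = (4 : ℤ) • (q / 4) := by rw [zsmul_eq_mul]; push_cast; ring
      rw [this, ← TensorProduct.smul_tmul, h4, TensorProduct.zero_tmul]
  have : Subsingleton (rationalHomology (G n) 1) :=
    (groupHomology.H1AddEquivOfIsTrivial (Rep.trivial ℚ (G n) ℚ)).toEquiv.subsingleton
  exact Module.finrank_zero_of_subsingleton

end Abelianization

/-! ### Triviality of the center -/

section Center

/-- A homomorphism out of `G_n` from elements whose squares are trivial. -/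
def liftInvolutions {K : Type*} [Group K] (f : Fin n → K) (hf : ∀ i, f i ^ 2 = 1) : G n →* K :=
  liftHom f fun i j _ => by simp [hf]

theorem sqSubgroup_le_ker_liftInvolutions {K : Type*} [Group K] (f : Fin n → K)
    (hf : ∀ i, f i ^ 2 = 1) (S : Finset (Fin n)) : sqSubgroup S ≤ (liftInvolutions f hf).ker :=
  sqSubgroup_le fun i _ => by
    rw [MonoidHom.mem_ker, liftInvolutions, map_pow, liftHom_gen, hf]

/-- The subgroup generated by all squares of generators and `x_j`. -/
def vertexGroup (j : Fin n) : Subgroup (G n) :=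
  Subgroup.zpowers (gen j) ⊔ sqSubgroup Finset.univ

theorem gen_mem_vertexGroup (j : Fin n) : gen j ∈ vertexGroup j :=
  Subgroup.mem_sup_left (Subgroup.mem_zpowers _)

theorem gen_sq_smul (i j : Fin n) (p : G n ⧸ vertexGroup j) : gen i • gen i • p = p := by
  induction p using QuotientGroup.induction_on with
  | H g =>
    rw [smul_smul, MulAction.Quotient.smul_coe, eq_comm, QuotientGroup.eq, smul_eq_mul,
      ← pow_two, ← mul_assoc]
    exact Subgroup.mem_sup_right
      (sqSubgroup_conj_mem' _ _ _ (gen_sq_mem (Finset.mem_univ i)))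

theorem gen_smul_eq_one_iff (j : Fin n) (p : G n ⧸ vertexGroup j) :
    gen j • p = ((1 : G n) : G n ⧸ vertexGroup j) ↔ p = ((1 : G n) : G n ⧸ vertexGroup j) := by
  have : gen j • ((1 : G n) : G n ⧸ vertexGroup j) = ((1 : G n) : G n ⧸ vertexGroup j) := by
    rw [MulAction.Quotient.smul_coe, eq_comm, QuotientGroup.eq]
    simpa using gen_mem_vertexGroup j
  constructor
  · intro h
    rw [← this] at h
    exact smul_left_cancel _ h
  · rintro rfl
    exact this

open Classical in
/-- The action of `x_i` on a trivial double cover of `G_n ⧸ vertexGroup j`, where `x_j` interchanges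
the sheets at the base point. -/
noncomputable def flipGen (j i : Fin n) : Equiv.Perm ((G n ⧸ vertexGroup j) × ZMod 2) :=
  Function.Involutive.toPerm (fun p => (gen i • p.1, p.2 +
      if i = j ∧ p.1 = ((1 : G n) : G n ⧸ vertexGroup j) then 1 else 0)) fun p => by
    refine Prod.ext (gen_sq_smul i j p.1) ?_
    have h : (i = j ∧ gen i • p.1 = ((1 : G n) : G n ⧸ vertexGroup j)) ↔
        (i = j ∧ p.1 = ((1 : G n) : G n ⧸ vertexGroup j)) :=
      and_congr_right fun e => by rw [e, gen_smul_eq_one_iff]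
    simp only [h, add_assoc, CharTwo.add_self_eq_zero, add_zero]

open Classical in
theorem flipGen_apply (j i : Fin n) (p : (G n ⧸ vertexGroup j) × ZMod 2) :
    flipGen j i p = (gen i • p.1, p.2 +
      if i = j ∧ p.1 = ((1 : G n) : G n ⧸ vertexGroup j) then 1 else 0) :=
  rfl

theorem flipGen_sq (j i : Fin n) : flipGen j i ^ 2 = 1 := by
  refine Equiv.ext fun p => ?_
  rw [pow_two, Equiv.Perm.mul_apply]
  exact (flipGen j i).left_inv p

/-- The action of `G_n` on the double cover of `G_n ⧸ vertexGroup j`. -/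
noncomputable def flipAction (j : Fin n) : G n →* Equiv.Perm ((G n ⧸ vertexGroup j) × ZMod 2) :=
  liftInvolutions (flipGen j) (flipGen_sq j)

open Classical in
theorem flipAction_gen (j : Fin n) (p : G n ⧸ vertexGroup j) (t : ZMod 2) :
    flipAction j (gen j) (p, t) =
      (gen j • p, t + if p = ((1 : G n) : G n ⧸ vertexGroup j) then 1 else 0) := by
  rw [flipAction, liftInvolutions, liftHom_gen]
  simp [flipGen_apply]

/-- The action covers the one on cosets and commutes with translating the sheets. -/
theorem flipAction_add (j : Fin n) (g : G n) (p : G n ⧸ vertexGroup j) (s t : ZMod 2) :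
    flipAction j g (p, s + t) = (g • p, (flipAction j g (p, s)).2 + t) := by
  induction g using gen_induction generalizing p s t with
  | one => simp
  | gen i =>
    rw [flipAction, liftInvolutions, liftHom_gen]
    rw [flipGen_apply, flipGen_apply, add_right_comm]
  | mul g h hg hh =>
    have h0 : flipAction j h (p, s) = (h • p, (flipAction j h (p, s)).2) := by
      simpa using hh p s 0
    rw [map_mul, Equiv.Perm.mul_apply, hh, hg, Equiv.Perm.mul_apply, ← h0, mul_smul]
  | inv g hg =>
    have h0 : ∀ q s, (flipAction j g (q, s)).1 = g • q := fun q s => by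
      simpa using congrArg Prod.fst (hg q s 0)
    rw [map_inv, Equiv.Perm.inv_eq_iff_eq, hg, smul_inv_smul]
    have e : flipAction j g ((flipAction j g)⁻¹ (p, s)) = (p, s) := by simp
    have e1 : ((flipAction j g)⁻¹ (p, s)).1 = g⁻¹ • p := by
      rw [eq_inv_smul_iff, ← h0 _ ((flipAction j g)⁻¹ (p, s)).2, Prod.mk.eta, e]
    rw [← e1, Prod.mk.eta, e]

/-- If `z` moves the base point, then `x_j z` and `z x_j` act differently on it: in the second
product `x_j` flips the sheet, in the first it acts away from the base point and does not. -/
theorem mem_vertexGroup_of_mem_center {z : G n} (hz : z ∈ Subgroup.center (G n)) (j : Fin n) :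
    z ∈ vertexGroup j := by
  classical
  by_contra hne
  have hb : z • ((1 : G n) : G n ⧸ vertexGroup j) ≠ ((1 : G n) : G n ⧸ vertexGroup j) := by
    rw [MulAction.Quotient.smul_coe, Ne, eq_comm, QuotientGroup.eq]
    simpa using hne
  have hc := congrArg (fun g => flipAction j g (((1 : G n) : G n ⧸ vertexGroup j), 0))
    (Subgroup.mem_center_iff.1 hz (gen j))
  have h0 := flipAction_add j z ((1 : G n) : G n ⧸ vertexGroup j) 0 0
  rw [add_zero, add_zero] at h0
  simp only [map_mul, Equiv.Perm.mul_apply] at hc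
  rw [h0, flipAction_gen, flipAction_gen, if_neg hb, if_pos rfl,
    (gen_smul_eq_one_iff j _).2 rfl, flipAction_add] at hc
  simpa using congrArg Prod.snd hc

theorem coordHom_gen_self_zpow (k : Fin n) (m : ℤ) (z : ℤ) :
    coordHom k (gen k ^ m) z = z + m := by
  cases m with
  | ofNat m => simpa using coordHom_gen_self_pow k m z
  | negSucc m =>
    rw [zpow_negSucc, map_inv, Equiv.Perm.inv_eq_iff_eq, coordHom_gen_self_pow, Int.negSucc_eq]
    push_cast
    ring

theorem mem_sqSubgroup_of_mem_center (hn : 1 < n) {z : G n} (hz : z ∈ Subgroup.center (G n)) :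
    z ∈ sqSubgroup (Finset.univ : Finset (Fin n)) := by
  have : Nontrivial (Fin n) := Fin.nontrivial_iff_two_le.2 hn
  obtain ⟨i, j, hij⟩ := exists_pair_ne (Fin n)
  -- The parity of `x_j` is zero on `x_i^m a`, so the exponent of `x_j` in the other expression for
  -- `z` is even.
  let f : Fin n → Multiplicative (ZMod 2) := fun k => Multiplicative.ofAdd (if k = j then 1 else 0)
  have hf : ∀ k, f k ^ 2 = 1 := fun k => by
    have : ∀ x : Multiplicative (ZMod 2), x ^ 2 = 1 := by decide
    exact this _
  have hv : ∀ k, ∃ m : ℤ, ∃ a ∈ sqSubgroup (Finset.univ : Finset (Fin n)), z = gen k ^ m * a :=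
    fun k => by
      obtain ⟨_, ⟨m, rfl⟩, a, ha, rfl⟩ :=
        Subgroup.mem_sup_of_normal_right.1 (mem_vertexGroup_of_mem_center hz k)
      exact ⟨m, a, ha, rfl⟩
  have himg : ∀ k (m : ℤ), ∀ a ∈ sqSubgroup (Finset.univ : Finset (Fin n)),
      liftInvolutions f hf (gen k ^ m * a) = f k ^ m := fun k m a ha => by
    rw [map_mul, MonoidHom.mem_ker.1 (sqSubgroup_le_ker_liftInvolutions f hf _ ha), mul_one,
      map_zpow, liftInvolutions, liftHom_gen]
  obtain ⟨m, a, ha, hm⟩ := hv i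
  obtain ⟨m', a', ha', hm'⟩ := hv j
  have h1 := himg i m a ha
  have h2 := himg j m' a' ha'
  rw [← hm] at h1
  rw [← hm', h1] at h2
  have h3 : (m' : ZMod 2) = 0 := by
    have := congrArg Multiplicative.toAdd h2
    simpa [f, hij, eq_comm] using this
  obtain ⟨q, hq⟩ := (ZMod.intCast_zmod_eq_zero_iff_dvd m' 2).1 h3
  rw [hm', hq, Nat.cast_ofNat, zpow_mul]
  exact mul_mem (zpow_mem (gen_sq_mem (Finset.mem_univ j)) q) ha'

theorem eq_one_of_mem_center_of_mem_sqSubgroup (hn : 1 < n) {z : G n}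
    (hz : z ∈ Subgroup.center (G n)) (S : Finset (Fin n)) (hS : z ∈ sqSubgroup S) : z = 1 := by
  have : Nontrivial (Fin n) := Fin.nontrivial_iff_two_le.2 hn
  induction S using Finset.induction_on with
  | empty => simpa [sqSubgroup] using hS
  | insert k S hk ih =>
    obtain ⟨m, h, hh, rfl⟩ := exists_zpow_mul_of_mem_sqSubgroup (k := k) hS
    rw [Finset.erase_insert hk] at hh
    have hm : ∀ t, coordHom k ((gen k ^ 2) ^ m * h) t = t + 2 * m := fun t => by
      rw [map_mul, MonoidHom.mem_ker.1 (sqSubgroup_le_ker_coordHom hk hh), mul_one,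
        ← zpow_natCast, ← zpow_mul, coordHom_gen_self_zpow]
      rfl
    obtain ⟨j, hj⟩ := exists_ne k
    have hc := congrArg (fun g => coordHom k g 0) (Subgroup.mem_center_iff.1 hz (gen j))
    simp only [map_mul (coordHom k) (gen j), map_mul (coordHom k) _ (gen j),
      Equiv.Perm.mul_apply, hm, coordHom_gen_of_ne hj, Equiv.neg_apply] at hc
    -- Translation by `2m` commutes with the reflection `x_j`, so `-2m = 2m`.
    obtain rfl : m = 0 := by omega
    refine ih ?_
    simpa using hh

theorem center_eq_bot (hn : 1 < n) : Subgroup.center (G n) = ⊥ :=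
  (Subgroup.eq_bot_iff_forall _).2 fun _ hz =>
    eq_one_of_mem_center_of_mem_sqSubgroup hn hz _ (mem_sqSubgroup_of_mem_center hn hz)

end Center

end HantzscheWendt

theorem mainTheorem8 (n : ℕ) :
    (1 < n →
      Nonempty (Abelianization (HantzscheWendt.G n) ≃* Multiplicative (Fin n → ZMod 4))) ∧
    (1 < n → Subgroup.center (HantzscheWendt.G n) = ⊥) ∧
    (1 ≤ n → HantzscheWendt.HasFiniteRationalHomology (HantzscheWendt.G n) ∧
      HantzscheWendt.eulerCharacteristic (HantzscheWendt.G n) = 0) ∧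
    (1 < n → HantzscheWendt.bettiNumber (HantzscheWendt.G n) 1 = 0) :=
  ⟨fun hn => ⟨HantzscheWendt.abelianizationEquiv hn⟩, HantzscheWendt.center_eq_bot,
    HantzscheWendt.hasFiniteRationalHomology_and_eulerCharacteristic,
    HantzscheWendt.bettiNumber_one⟩
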